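/- Let $\mathbb T^n=(\mathbb R/2\pi\mathbb Z)^n$ with normalized Lebesgue measure, and identify (formal) Fourier series $U(y)=\sum_{k\in\mathbb Z^n}\widehat U_k e^{\mathrm i k\cdot y}$ on $\mathbb T^n$ with their complex coefficients; $|\cdot|$ is the Euclidean norm. Let $P\in\mathbb R^{d\times n}$ have columns that are linearly independent over $\mathbb Q$. For $\sigma\in\mathbb R$ let $$H_0^{\sigma}(\mathbb T^n)=\Big\{U:\widehat U_0=0,\ \|U\|_{H^{\sigma}}^2=\sum_{k}(1+|k|^2)^{\sigma}|\widehat U_k|^2<\infty\Big\},\qquad \overline H^{\sigma}_{P,0}(\mathbb T^n)=\Big\{U:\widehat U_0=0,\ \|U\|_{\overline H^{\sigma}_{P,0}}^2=\sum_{k\ne0}|Pk|^{2\sigma}|\widehat U_k|^2<\infty\Big\},$$ and $\|U\|_{L^2}^2=\sum_k|\widehat U_k|^2$. For $U\in\overline H^1_{P,0}(\mathbb T^n)$ let $P\nabla U=\sum_{k}\mathrm i\,(Pk)\,\widehat U_k e^{\mathrm i k\cdot y}\in L^2(\mathbb T^n;\mathbb C^d)$. Let $s\ge 0$. Assume that *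 there are $c>0$ and $\tau>0$ with $|Pk|\ge c|k|^{-\tau}$ for all $k\in\mathbb Z^n\setminus\{0\}$; * $A:\mathbb T^n\to\mathbb R$ is measurable with $0<\alpha_0\le A(y)\le\alpha_1<\infty$ for all $y$, and $|\widehat A_k|\le C_A(1+|k|)^{-N}$ for all $k\in\mathbb Z^n$, where $N>n+s+\tau$; * $F\in H_0^{2\tau+s+1}(\mathbb T^n)$. Then there is a unique $U\in\overline H^1_{P,0}(\mathbb T^n)$ such that $$\int_{\mathbb T^n}A\,P\nabla U\cdot\overline{P\nabla V}\,dy=\sum_{k\ne0}\widehat F_k\overline{\widehat V_k}\qquad\text{for all }V\in\overline H^1_{P,0}(\mathbb T^n),$$ this $U$ belongs to $H_0^{s+1}(\mathbb T^n)$, and for every $K>0$ its Fourier truncation $\Pi_KU=\sum_{0<|k|\le K}\widehat U_k e^{\mathrm i k\cdot y}$ satisfies $$\|U-\Pi_KU\|_{\overline H^1_{P,0}}\le C K^{-s}\|U\|_{H^{s+1}},\qquad \|U-\Pi_KU\|_{L^2}\le C K^{-(s+1)}\|U\|_{H^{s+1}},$$ with a constant $C>0$ depending only on $P$ (in particular not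 on $s$, $A$, $F$, $U$ or $K$). -/

import Mathlib

open MeasureTheory
open scoped ComplexConjugate

noncomputable section

namespace QuasiPer

/-- The torus `(ℝ / 2πℤ)ⁿ`. -/
abbrev Torus (n : ℕ) : Type := Fin n → AddCircle (2 * Real.pi)

/-- Needed for the Haar measure and the Fourier monomials of `ℝ / 2πℤ`. -/
instance fact_two_pi_pos : Fact (0 < 2 * Real.pi) := ⟨Real.two_pi_pos⟩

/-- The normalized (total mass one) Lebesgue measure on the torus. -/
abbrev torusMeasure (n : ℕ) : Measure (Torus n) :=
  Measure.pi fun _ => AddCircle.haarAddCircle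

/-- The monomial `y ↦ exp (i k ⬝ y)`; Mathlib's `fourier m` on `AddCircle (2π)` is
`y ↦ exp (i m y)`. -/
def monomial {n : ℕ} (k : Fin n → ℤ) : C(Torus n, ℂ) where
  toFun y := ∏ i, fourier (k i) (y i)
  continuous_toFun := by fun_prop

/-- The monomial `exp (i k ⬝ y)` as an element of `L²` of the torus. -/
def monomialL2 {n : ℕ} (k : Fin n → ℤ) : Lp ℂ 2 (torusMeasure n) :=
  ContinuousMap.toLp 2 (torusMeasure n) ℂ (monomial k)

/-- The `k`-th Fourier coefficient of a real function on the torus. -/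
def fourierCoeffReal {n : ℕ} (A : Torus n → ℝ) (k : Fin n → ℤ) : ℂ :=
  ∫ y, (A y : ℂ) * conj (monomial k y) ∂(torusMeasure n)

/-- The Euclidean length `|k|` of an integer vector. -/
def freqNorm {n : ℕ} (k : Fin n → ℤ) : ℝ :=
  √(∑ i, (k i : ℝ) ^ 2)

/-- The projected frequency `P k`. -/
def projFreq {d n : ℕ} (P : Matrix (Fin d) (Fin n) ℝ) (k : Fin n → ℤ) : Fin d → ℝ :=
  P.mulVec fun i => (k i : ℝ)

/-- The Euclidean length `|P k|` of a projected frequency. -/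
def projNorm {d n : ℕ} (P : Matrix (Fin d) (Fin n) ℝ) (k : Fin n → ℤ) : ℝ :=
  √(∑ j, projFreq P k j ^ 2)

/-- `P` is a projection matrix: its columns are linearly independent over `ℚ`. -/
def IsProjectionMatrix {d n : ℕ} (P : Matrix (Fin d) (Fin n) ℝ) : Prop :=
  LinearIndependent ℚ fun i : Fin n => P.col i

/-- The Diophantine condition with exponent `τ`: `|P k| ≥ c |k|^{-τ}` for all `k ≠ 0`. -/
def IsDiophantine {d n : ℕ} (P : Matrix (Fin d) (Fin n) ℝ) (τ : ℝ) : Prop :=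
  0 < τ ∧ ∃ c : ℝ, 0 < c ∧ ∀ k : Fin n → ℤ, k ≠ 0 → c * freqNorm k ^ (-τ) ≤ projNorm P k

/-- The coefficient has positive lower and finite upper bounds. -/
def IsElliptic {n : ℕ} (A : Torus n → ℝ) : Prop :=
  ∃ α₀ α₁ : ℝ, 0 < α₀ ∧ ∀ y, α₀ ≤ A y ∧ A y ≤ α₁

/-- The Fourier coefficients of `A` decay at rate `N`. -/
def HasFourierDecay {n : ℕ} (A : Torus n → ℝ) (N : ℝ) : Prop :=
  ∃ CA : ℝ, 0 < CA ∧ ∀ k : Fin n → ℤ, ‖fourierCoeffReal A k‖ ≤ CA * (1 + freqNorm k) ^ (-N)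

/-- A formal Fourier series `∑ k, U k * exp (i k ⬝ y)` on the torus, given by its coefficients.
The function spaces below are spaces of such series: an element of the homogeneous `P`-projected
space of order one need not be square integrable. -/
abbrev FourierSeries (n : ℕ) : Type := (Fin n → ℤ) → ℂ

/-- The norm of `L²` of the torus, in terms of Fourier coefficients. -/
def normL2 {n : ℕ} (U : FourierSeries n) : ℝ :=
  √(∑' k, ‖U k‖ ^ 2)

/-- The norm of the Sobolev space `H^s` of the torus. -/
def normH {n : ℕ} (s : ℝ) (U : FourierSeries n) : ℝ :=
  √(∑' k, (1 + freqNorm k ^ 2) ^ s * ‖U k‖ ^ 2)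

/-- The space `H_0^s` of the torus: zero mean and finite `H^s` norm. -/
def H0 (n : ℕ) (s : ℝ) : Set (FourierSeries n) :=
  {U | U 0 = 0 ∧ Summable fun k => (1 + freqNorm k ^ 2) ^ s * ‖U k‖ ^ 2}

/-- The norm of the homogeneous `P`-projected space of order `s`. It is used for series with
`U 0 = 0`, so that the term `k = 0` vanishes for every real `s`. -/
def normHbarP {d n : ℕ} (P : Matrix (Fin d) (Fin n) ℝ) (s : ℝ) (U : FourierSeries n) : ℝ :=
  √(∑' k, projNorm P k ^ (2 * s) * ‖U k‖ ^ 2)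

/-- The zero-mean homogeneous `P`-projected space of order `s`. -/
def HbarP0 {d n : ℕ} (P : Matrix (Fin d) (Fin n) ℝ) (s : ℝ) : Set (FourierSeries n) :=
  {U | U 0 = 0 ∧ Summable fun k => projNorm P k ^ (2 * s) * ‖U k‖ ^ 2}

/-- The `j`-th component of `P ∇ U`, the `L²` function `∑ k, i (P k)_j U_k exp (i k ⬝ y)`.
The series converges unconditionally in `L²` when `U ∈ HbarP0 P 1`. -/
def projGrad {d n : ℕ} (P : Matrix (Fin d) (Fin n) ℝ) (U : FourierSeries n) (j : Fin d) :
    Lp ℂ 2 (torusMeasure n) :=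
  ∑' k, (Complex.I * (projFreq P k j : ℂ) * U k) • monomialL2 k

/-- The form `a(U, V) = (A P∇U, P∇V)`, an integral over the torus. -/
def energyForm {d n : ℕ} (P : Matrix (Fin d) (Fin n) ℝ) (A : Torus n → ℝ)
    (U V : FourierSeries n) : ℂ :=
  ∫ y, (A y : ℂ) * ∑ j, projGrad P U j y * conj (projGrad P V j y) ∂(torusMeasure n)

/-- The duality pairing `⟨F, V⟩` extending the `L²` inner product. -/
def pairing {n : ℕ} (F V : FourierSeries n) : ℂ :=
  ∑' k, F k * conj (V k)

/-- `U` solves the variational problem: `U ∈ HbarP0 P 1` and `a(U, V) = ⟨F, V⟩` for every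
`V ∈ HbarP0 P 1`. -/
def IsVariationalSolution {d n : ℕ} (P : Matrix (Fin d) (Fin n) ℝ) (A : Torus n → ℝ)
    (F U : FourierSeries n) : Prop :=
  U ∈ HbarP0 P 1 ∧ ∀ V ∈ HbarP0 P 1, energyForm P A U V = pairing F V

open Classical in
/-- The Fourier truncation `Π_K U`, keeping the frequencies `0 < |k| ≤ K`. -/
def fourierTrunc {n : ℕ} (K : ℝ) (U : FourierSeries n) : FourierSeries n :=
  fun k => if 0 < freqNorm k ∧ freqNorm k ≤ K then U k else 0

end QuasiPer

end

open QuasiPer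

/-!
Rescaling the coefficients to `u k = |P k| U_k` turns the variational problem into an equation
`T u = f` in `ℓ²` of the nonzero frequencies, where `T` is bounded, coercive, and has matrix entries
bounded by the Fourier coefficients of `A` at `k - l`. Unique solvability is then Lax–Milgram.

Regularity says that `|k| ^ σ u k` is square summable if `|k| ^ σ f k` is. Let `W` be the diagonal
operator with entries `max R |k| ^ σ`. The error `S = W T W⁻¹ - T` has small norm for `R` large:
the ratio of the weights at `k` and `l` is close to `1` where `|k - l|` is small compared with
`max R |l|`, and there the Schur test applies; elsewhere the decay of `T` bounds the entries of `S`
by a small multiple of `|k| ^ (-p) |l| ^ (-p)` with `p > n / 2`. Hence `T + S` is still invertible,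
and `u = W⁻¹ (T + S)⁻¹ W f`. The Diophantine condition converts between `U` and `u`, and between
`F` and `f`.
-/

namespace QuasiPer

open scoped lp NNReal

section SquareSummable

variable {ι κ 𝕜 : Type*} [RCLike 𝕜]

theorem memℓp_two_iff_summable_sq {E : Type*} [NormedAddCommGroup E] {f : ι → E} :
    Memℓp f 2 ↔ Summable fun i => ‖f i‖ ^ 2 := by
  rw [memℓp_gen_iff (by norm_num)]
  simp

theorem lp_two_summable_sq (u : ℓ²(ι, 𝕜)) : Summable fun i => ‖u i‖ ^ 2 :=
  memℓp_two_iff_summable_sq.1 (lp.memℓp u)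

theorem lp_two_norm_sq (u : ℓ²(ι, 𝕜)) : ‖u‖ ^ 2 = ∑' i, ‖u i‖ ^ 2 := by
  simpa using lp.norm_rpow_eq_tsum (p := 2) (by norm_num) u

theorem lp_two_clm_ext [DecidableEq ι] {F : Type*} [NormedAddCommGroup F] [NormedSpace 𝕜 F]
    {S T : ℓ²(ι, 𝕜) →L[𝕜] F} (h : ∀ i, S (lp.single 2 i 1) = T (lp.single 2 i 1)) : S = T := by
  refine lp.ext_continuousLinearMap (by norm_num) fun i => ?_
  ext
  simpa using h i

/-- The operator multiplying the `k`-th coordinate by `a k`. -/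
noncomputable def diagOp (a : ι → 𝕜) {C : ℝ} (hC : 0 ≤ C) (ha : ∀ k, ‖a k‖ ≤ C) :
    ℓ²(ι, 𝕜) →L[𝕜] ℓ²(ι, 𝕜) :=
  lp.mapCLM 2 (fun k => a k • ContinuousLinearMap.id 𝕜 𝕜) hC fun k => by
    rw [norm_smul]
    simpa using ha k

@[simp]
theorem diagOp_apply (a : ι → 𝕜) {C : ℝ} (hC : 0 ≤ C) (ha : ∀ k, ‖a k‖ ≤ C)
    (u : ℓ²(ι, 𝕜)) (k : ι) : diagOp a hC ha u k = a k * u k := by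
  simp [diagOp]

theorem diagOp_single [DecidableEq ι] (a : ι → 𝕜) {C : ℝ} (hC : 0 ≤ C) (ha : ∀ k, ‖a k‖ ≤ C)
    (l : ι) (c : 𝕜) : diagOp a hC ha (lp.single 2 l c) = lp.single 2 l (a l * c) := by
  ext k
  by_cases h : k = l
  · subst h; simp
  · simp [Pi.single_eq_of_ne h]

theorem summable_of_sq_norm_sum_le {z : ι → 𝕜} {a : ι → ℝ} {C : ℝ} (ha : Summable a)
    (h : ∀ s : Finset ι, ‖∑ i ∈ s, z i‖ ^ 2 ≤ C * ∑ i ∈ s, a i) : Summable z := by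
  refine summable_iff_vanishing_norm.2 fun ε hε => ?_
  obtain ⟨δ, hδ, hCδ⟩ := exists_pos_mul_lt (pow_pos hε 2) |C|
  obtain ⟨s, hs⟩ := summable_iff_vanishing_norm.1 ha δ hδ
  refine ⟨s, fun t ht => lt_of_pow_lt_pow_left₀ 2 hε.le ?_⟩
  calc ‖∑ i ∈ t, z i‖ ^ 2 ≤ |C * ∑ i ∈ t, a i| := (h t).trans (le_abs_self _)
    _ = |C| * ‖∑ i ∈ t, a i‖ := abs_mul _ _
    _ ≤ |C| * δ := by gcongr; exact (hs t ht).le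
    _ < ε ^ 2 := hCδ

theorem exists_clm_of_sum_sq_le [DecidableEq ι] (E : κ → ι → 𝕜) {C : ℝ} (hC : 0 ≤ C)
    (hE : ∀ (u : ι → 𝕜) (s : Finset ι) (t : Finset κ),
      ∑ k ∈ t, ‖∑ l ∈ s, E k l * u l‖ ^ 2 ≤ C ^ 2 * ∑ l ∈ s, ‖u l‖ ^ 2) :
    ∃ S : ℓ²(ι, 𝕜) →L[𝕜] ℓ²(κ, 𝕜), ‖S‖ ≤ C ∧ ∀ k l, S (lp.single 2 l 1) k = E k l := by
  have hrow (u : ℓ²(ι, 𝕜)) (k : κ) : Summable fun l => E k l * u l :=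
    summable_of_sq_norm_sum_le (lp_two_summable_sq u) fun s => by simpa using hE u s {k}
  have hbound (u : ℓ²(ι, 𝕜)) (t : Finset κ) :
      ∑ k ∈ t, ‖∑' l, E k l * u l‖ ^ 2 ≤ (C * ‖u‖) ^ 2 := by
    rw [mul_pow, lp_two_norm_sq]
    exact le_of_tendsto_of_tendsto'
      (tendsto_finsetSum _ fun k _ => ((hrow u k).hasSum.norm.pow 2))
      ((lp_two_summable_sq u).hasSum.const_mul _) fun s => hE u s t
  let S₀ : ℓ²(ι, 𝕜) →ₗ[𝕜] ℓ²(κ, 𝕜) :=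
    { toFun u := ⟨fun k => ∑' l, E k l * u l, memℓp_two_iff_summable_sq.2
        (summable_of_sum_le (fun _ => by positivity) (hbound u))⟩
      map_add' u v := by
        ext k
        simp only [lp.coeFn_add, Pi.add_apply, mul_add]
        exact (hrow u k).tsum_add (hrow v k)
      map_smul' c u := by
        ext k
        simp only [lp.coeFn_smul, Pi.smul_apply, smul_eq_mul, RingHom.id_apply, mul_left_comm _ c,
          tsum_mul_left] }
  have hS₀ (u : ℓ²(ι, 𝕜)) : ‖S₀ u‖ ≤ C * ‖u‖ :=
    lp.norm_le_of_forall_sum_le (by norm_num) (by positivity) fun t => by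
      simpa [S₀] using hbound u t
  refine ⟨S₀.mkContinuous C hS₀, LinearMap.mkContinuous_norm_le _ hC _, fun k l => ?_⟩
  change ∑' m, E k m * (lp.single 2 l (1 : 𝕜) : ℓ²(ι, 𝕜)) m = E k l
  rw [tsum_eq_single l fun m hm => by simp [Pi.single_eq_of_ne hm]]
  simp

theorem sum_sq_norm_sum_mul_le_of_schur (E : κ → ι → 𝕜) (v : κ → ℝ) {w : ι → ℝ} {C : ℝ}
    (hw : ∀ l, 0 < w l) (hrow : ∀ k (s : Finset ι), ∑ l ∈ s, ‖E k l‖ * w l ≤ C * v k)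
    (hcol : ∀ l (t : Finset κ), ∑ k ∈ t, v k * ‖E k l‖ ≤ C * w l) (hC : 0 ≤ C)
    (u : ι → 𝕜) (s : Finset ι) (t : Finset κ) :
    ∑ k ∈ t, ‖∑ l ∈ s, E k l * u l‖ ^ 2 ≤ C ^ 2 * ∑ l ∈ s, ‖u l‖ ^ 2 := by
  have hrow_sq (k : κ) : ‖∑ l ∈ s, E k l * u l‖ ^ 2 ≤
      C * v k * ∑ l ∈ s, ‖E k l‖ * (‖u l‖ ^ 2 / w l) := by
    have hw₀ (l : ι) : 0 ≤ w l := (hw l).le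
    calc ‖∑ l ∈ s, E k l * u l‖ ^ 2 ≤ (∑ l ∈ s, ‖E k l‖ * ‖u l‖) ^ 2 := by
          gcongr
          exact norm_sum_le_of_le s fun l _ => norm_mul_le _ _
      _ ≤ (∑ l ∈ s, ‖E k l‖ * w l) * ∑ l ∈ s, ‖E k l‖ * (‖u l‖ ^ 2 / w l) := by
          refine Finset.sum_sq_le_sum_mul_sum_of_sq_le_mul s
            (fun l _ => mul_nonneg (norm_nonneg _) (hw₀ l))
            (fun l _ => mul_nonneg (norm_nonneg _) (div_nonneg (sq_nonneg _) (hw₀ l)))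
            fun l _ => ?_
          have := hw l
          exact le_of_eq (by field_simp)
      _ ≤ _ := by
          gcongr
          · exact Finset.sum_nonneg fun l _ =>
              mul_nonneg (norm_nonneg _) (div_nonneg (sq_nonneg _) (hw₀ l))
          · exact hrow k s
  calc ∑ k ∈ t, ‖∑ l ∈ s, E k l * u l‖ ^ 2
      ≤ ∑ k ∈ t, C * v k * ∑ l ∈ s, ‖E k l‖ * (‖u l‖ ^ 2 / w l) :=
        Finset.sum_le_sum fun k _ => hrow_sq k
    _ = C * ∑ l ∈ s, (∑ k ∈ t, v k * ‖E k l‖) * (‖u l‖ ^ 2 / w l) := by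
        simp only [Finset.mul_sum, Finset.sum_mul]
        rw [Finset.sum_comm]
        simp only [mul_assoc]
    _ ≤ C * ∑ l ∈ s, C * w l * (‖u l‖ ^ 2 / w l) := by
        gcongr with l
        · exact div_nonneg (sq_nonneg _) (hw l).le
        · exact hcol l t
    _ = C ^ 2 * ∑ l ∈ s, ‖u l‖ ^ 2 := by
        simp only [mul_assoc, mul_div_cancel₀ _ (hw _).ne', ← Finset.mul_sum, sq C]

theorem exists_clm_of_schur [DecidableEq ι] (E : κ → ι → 𝕜) (v : κ → ℝ) {w : ι → ℝ} {C : ℝ}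
    (hC : 0 ≤ C) (hw : ∀ l, 0 < w l)
    (hrow : ∀ k (s : Finset ι), ∑ l ∈ s, ‖E k l‖ * w l ≤ C * v k)
    (hcol : ∀ l (t : Finset κ), ∑ k ∈ t, v k * ‖E k l‖ ≤ C * w l) :
    ∃ S : ℓ²(ι, 𝕜) →L[𝕜] ℓ²(κ, 𝕜), ‖S‖ ≤ C ∧ ∀ k l, S (lp.single 2 l 1) k = E k l :=
  exists_clm_of_sum_sq_le E hC (sum_sq_norm_sum_mul_le_of_schur E v hw hrow hcol hC)

theorem sum_comp_le_tsum_of_injective {G : Type*} {g : G → ℝ} (hg : Summable g)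
    (hg₀ : ∀ x, 0 ≤ g x) {f : ι → G} (hf : f.Injective) (s : Finset ι) :
    ∑ i ∈ s, g (f i) ≤ ∑' x, g x :=
  ((hg.comp_injective hf).sum_le_tsum s fun _ _ => hg₀ _).trans
    (tsum_comp_le_tsum_of_inj hg hg₀ hf)

theorem exists_clm_of_norm_le_sub [DecidableEq ι] {G : Type*} [AddGroup G] (E : ι → ι → 𝕜)
    {g : G → ℝ} {e : ι → G} (he : e.Injective) (hg : Summable g) (hg₀ : ∀ x, 0 ≤ g x)
    (hE : ∀ k l, ‖E k l‖ ≤ g (e k - e l)) :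
    ∃ S : ℓ²(ι, 𝕜) →L[𝕜] ℓ²(ι, 𝕜),
      ‖S‖ ≤ ∑' x, g x ∧ ∀ k l, S (lp.single 2 l 1) k = E k l := by
  refine exists_clm_of_schur E 1 (w := 1) (tsum_nonneg hg₀) (fun _ => one_pos) (fun k s => ?_)
    fun l t => ?_
  · simp only [Pi.one_apply, mul_one]
    exact (Finset.sum_le_sum fun l _ => hE k l).trans
      (sum_comp_le_tsum_of_injective hg hg₀ (sub_right_injective.comp he) s)
  · simp only [Pi.one_apply, one_mul, mul_one]
    exact (Finset.sum_le_sum fun k _ => hE k l).trans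
      (sum_comp_le_tsum_of_injective hg hg₀ (sub_left_injective.comp he) t)

theorem exists_clm_of_norm_le_mul [DecidableEq ι] (E : ι → ι → 𝕜) {φ : ι → ℝ} {C : ℝ}
    (hC : 0 ≤ C) (hφ₀ : ∀ k, 0 < φ k) (hφ : Summable fun k => φ k ^ 2)
    (hE : ∀ k l, ‖E k l‖ ≤ C * (φ k * φ l)) :
    ∃ S : ℓ²(ι, 𝕜) →L[𝕜] ℓ²(ι, 𝕜),
      ‖S‖ ≤ C * ∑' k, φ k ^ 2 ∧ ∀ k l, S (lp.single 2 l 1) k = E k l := by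
  have hsum (c : ℝ) (hc : 0 ≤ c) (s : Finset ι) :
      ∑ i ∈ s, C * c * φ i ^ 2 ≤ C * (∑' k, φ k ^ 2) * c := by
    rw [← Finset.mul_sum, mul_right_comm C]
    gcongr
    exact hφ.sum_le_tsum s fun _ _ => sq_nonneg _
  refine exists_clm_of_schur E φ (by positivity) hφ₀ (fun k s => ?_) fun l t => ?_
  · refine (Finset.sum_le_sum fun l _ => ?_).trans (hsum (φ k) (hφ₀ k).le s)
    calc ‖E k l‖ * φ l ≤ C * (φ k * φ l) * φ l := by gcongr; exacts [(hφ₀ l).le, hE k l]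
      _ = C * φ k * φ l ^ 2 := by ring
  · refine (Finset.sum_le_sum fun k _ => ?_).trans (hsum (φ l) (hφ₀ l).le t)
    calc φ k * ‖E k l‖ ≤ φ k * (C * (φ k * φ l)) := by gcongr; exacts [(hφ₀ k).le, hE k l]
      _ = C * φ l * φ k ^ 2 := by ring

end SquareSummable

section Coercive

variable {𝕜 H : Type*} [RCLike 𝕜] [NormedAddCommGroup H] [InnerProductSpace 𝕜 H] [CompleteSpace H]

theorem isUnit_of_coercive {T : H →L[𝕜] H} {α : ℝ} (hα : 0 < α)
    (hT : ∀ u, α * ‖u‖ ^ 2 ≤ RCLike.re (inner 𝕜 u (T u))) : IsUnit T := by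
  lift α to ℝ≥0 using hα.le
  refine T.isUnit_of_forall_le_norm_inner_map (by exact_mod_cast hα) fun u => ?_
  rw [mul_comm, norm_inner_symm]
  exact (hT u).trans (RCLike.re_le_norm _)

theorem isUnit_add_of_coercive {T S : H →L[𝕜] H} {α : ℝ}
    (hT : ∀ u, α * ‖u‖ ^ 2 ≤ RCLike.re (inner 𝕜 u (T u))) (hS : ‖S‖ < α) : IsUnit (T + S) := by
  refine isUnit_of_coercive (sub_pos.2 hS) fun u => ?_
  have hSu : -(‖S‖ * ‖u‖ ^ 2) ≤ RCLike.re (inner 𝕜 u (S u)) := by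
    refine neg_le_of_abs_le ((RCLike.abs_re_le_norm _).trans ((norm_inner_le_norm u _).trans ?_))
    calc ‖u‖ * ‖S u‖ ≤ ‖u‖ * (‖S‖ * ‖u‖) := by gcongr; exact S.le_opNorm u
      _ = ‖S‖ * ‖u‖ ^ 2 := by ring
  rw [add_apply, inner_add_right, map_add]
  linarith [hT u]

/-- If `W` is the diagonal operator with entries `W k`, then `W T W⁻¹ = T + S`, so that
`u = W⁻¹ (T + S)⁻¹ W (T u)`. -/
theorem memℓp_mul_of_coercive {ι : Type*} [DecidableEq ι] {T S : ℓ²(ι, 𝕜) →L[𝕜] ℓ²(ι, 𝕜)}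
    {α : ℝ} (hα : 0 < α) (hT : ∀ u, α * ‖u‖ ^ 2 ≤ RCLike.re (inner 𝕜 u (T u))) {W : ι → 𝕜}
    (hW : ∀ k, 1 ≤ ‖W k‖)
    (hS : ∀ k l, S (lp.single 2 l 1) k = (W k / W l - 1) * T (lp.single 2 l 1) k)
    (hSα : ‖S‖ < α) {u : ℓ²(ι, 𝕜)} (hu : Memℓp (fun k => W k * T u k) 2) :
    Memℓp (fun k => W k * u k) 2 := by
  have hW₀ (k : ι) : W k ≠ 0 := norm_ne_zero_iff.1 (one_pos.trans_le (hW k)).ne'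
  let D := diagOp (fun k => (W k)⁻¹) zero_le_one fun k => by
    rw [norm_inv]
    exact inv_le_one_of_one_le₀ (hW k)
  have hTD : T ∘L D = D ∘L (T + S) := lp_two_clm_ext fun l => by
    ext k
    have hsingle : (lp.single 2 l ((W l)⁻¹ * 1) : ℓ²(ι, 𝕜)) = (W l)⁻¹ • lp.single 2 l 1 := by
      rw [← lp.single_smul, smul_eq_mul]
    simp only [D, ContinuousLinearMap.comp_apply, diagOp_single, hsingle, map_smul,
      lp.coeFn_smul, Pi.smul_apply, smul_eq_mul, diagOp_apply, add_apply,
      lp.coeFn_add, Pi.add_apply, hS]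
    field_simp [hW₀ k, hW₀ l]
    ring
  have hbij := ContinuousLinearMap.isUnit_iff_bijective.1 (isUnit_add_of_coercive hT hSα)
  obtain ⟨w, hw⟩ := hbij.surjective ⟨_, hu⟩
  have hDw : D w = u := by
    refine (ContinuousLinearMap.isUnit_iff_bijective.1 (isUnit_of_coercive hα hT)).injective ?_
    rw [← ContinuousLinearMap.comp_apply, hTD, ContinuousLinearMap.comp_apply, hw]
    ext k
    simp [D, hW₀ k]
  convert lp.memℓp w using 2 with k
  rw [← hDw, diagOp_apply, mul_inv_cancel_left₀ (hW₀ k)]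

end Coercive

section MulOp

variable {X 𝕜 : Type*} [RCLike 𝕜] [MeasurableSpace X] {μ : Measure X} {φ : X → 𝕜}

/-- Multiplication by an essentially bounded function, as an operator on `L²`. -/
noncomputable def mulOp (hφ : MemLp φ ⊤ μ) : Lp 𝕜 2 μ →L[𝕜] Lp 𝕜 2 μ :=
  (ContinuousLinearMap.mul 𝕜 𝕜).holderL μ ⊤ 2 2 (hφ.toLp φ)

theorem coeFn_mulOp (hφ : MemLp φ ⊤ μ) (f : Lp 𝕜 2 μ) : mulOp hφ f =ᵐ[μ] fun x => φ x * f x := by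
  filter_upwards [(ContinuousLinearMap.mul 𝕜 𝕜).coeFn_holder (r := 2) (hφ.toLp φ) f, hφ.coeFn_toLp]
    with x hmul hcoe
  rw [← hcoe]
  exact hmul

theorem inner_mulOp_ae_eq (hφ : MemLp φ ⊤ μ) (f g : Lp 𝕜 2 μ) :
    (fun x => inner 𝕜 (g x) (mulOp hφ f x)) =ᵐ[μ] fun x => φ x * (f x * conj (g x)) := by
  filter_upwards [coeFn_mulOp hφ f] with x hx
  rw [RCLike.inner_apply, hx, mul_assoc]

theorem inner_mulOp (hφ : MemLp φ ⊤ μ) (f g : Lp 𝕜 2 μ) :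
    inner 𝕜 g (mulOp hφ f) = ∫ x, φ x * (f x * conj (g x)) ∂μ := by
  rw [L2.inner_def, integral_congr_ae (inner_mulOp_ae_eq hφ f g)]

theorem integrable_mul_mul_conj (hφ : MemLp φ ⊤ μ) (f g : Lp 𝕜 2 μ) :
    Integrable (fun x => φ x * (f x * conj (g x))) μ :=
  (L2.integrable_inner g (mulOp hφ f)).congr (inner_mulOp_ae_eq hφ f g)

theorem mul_norm_sq_le_re_inner_mulOp {a : X → ℝ} (ha : MemLp (fun x => (a x : 𝕜)) ⊤ μ) {α : ℝ}
    (hα : ∀ x, α ≤ a x) (f : Lp 𝕜 2 μ) : α * ‖f‖ ^ 2 ≤ RCLike.re (inner 𝕜 f (mulOp ha f)) := by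
  have hre (x : X) : RCLike.re ((a x : 𝕜) * (f x * conj (f x))) = a x * ‖f x‖ ^ 2 := by
    rw [RCLike.mul_conj]
    norm_cast
  have hintegrable := integrable_mul_mul_conj ha f f
  have hintegrable_re := hintegrable.re
  have hnorm : ‖f‖ ^ 2 = ∫ x, ‖f x‖ ^ 2 ∂μ := by
    rw [← inner_self_eq_norm_sq (𝕜 := 𝕜), L2.inner_def, ← integral_re (L2.integrable_inner f f)]
    simp only [inner_self_eq_norm_sq]
  rw [inner_mulOp, ← integral_re hintegrable, hnorm, ← integral_const_mul]
  simp only [hre] at hintegrable_re ⊢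
  exact integral_mono (((Lp.memLp f).integrable_norm_pow two_ne_zero).const_mul α) hintegrable_re
    fun x => mul_le_mul_of_nonneg_right (hα x) (sq_nonneg _)

end MulOp

section Monomials

variable {n : ℕ}

theorem conj_monomial_mul_monomial (k l : Fin n → ℤ) (y : Torus n) :
    conj (monomial k y) * monomial l y = monomial (l - k) y := by
  simp only [monomial, ContinuousMap.coe_mk, map_prod, ← Finset.prod_mul_distrib]
  refine Finset.prod_congr rfl fun i _ => ?_
  rw [← fourier_neg, ← fourier_add, Pi.sub_apply, neg_add_eq_sub]

theorem conj_monomial_sub (k l : Fin n → ℤ) (y : Torus n) :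
    conj (monomial (k - l) y) = monomial l y * conj (monomial k y) := by
  rw [← conj_monomial_mul_monomial, map_mul, Complex.conj_conj]

theorem integral_monomial (k : Fin n → ℤ) :
    ∫ y, monomial k y ∂(torusMeasure n) = if k = 0 then 1 else 0 := by
  have integral_fourier (m : ℤ) :
      ∫ x : AddCircle (2 * Real.pi), fourier m x ∂AddCircle.haarAddCircle =
        if m = 0 then 1 else 0 := by
    have h := orthonormal_iff_ite.1 (orthonormal_fourier (T := 2 * Real.pi)) 0 m
    rw [ContinuousMap.inner_toLp] at h
    simpa [eq_comm] using h
  simp only [monomial, ContinuousMap.coe_mk]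
  rw [integral_fintype_prod_eq_prod (fun i x => (fourier (k i) x : ℂ))]
  simp only [integral_fourier]
  split_ifs with hk
  · simp [hk]
  · obtain ⟨i, hi⟩ := Function.ne_iff.1 hk
    exact Finset.prod_eq_zero (Finset.mem_univ i) (by simpa using hi)

theorem orthonormal_monomialL2 : Orthonormal ℂ (monomialL2 (n := n)) := by
  rw [orthonormal_iff_ite]
  intro k l
  rw [monomialL2, monomialL2, ContinuousMap.inner_toLp]
  simp only [mul_comm (monomial l _), conj_monomial_mul_monomial]
  rw [integral_monomial]
  simp [sub_eq_zero, eq_comm]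

/-- The nonzero frequencies. -/
abbrev Freq (n : ℕ) : Type := {k : Fin n → ℤ // k ≠ 0}

/-- The square summable families indexed by the nonzero frequencies. -/
abbrev SeqSpace (n : ℕ) : Type := ℓ²(Freq n, ℂ)

/-- The isometry that sums a Fourier series without constant term. -/
noncomputable def synthesis (n : ℕ) : SeqSpace n →ₗᵢ[ℂ] Lp ℂ 2 (torusMeasure n) :=
  (orthonormal_monomialL2.comp _
    (Subtype.val_injective (p := (· ≠ 0)))).orthogonalFamily.linearIsometry

theorem synthesis_apply (u : SeqSpace n) :
    synthesis n u = ∑' k : Freq n, u k • monomialL2 k.1 := by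
  simp [synthesis, OrthogonalFamily.linearIsometry_apply]

theorem synthesis_single (k : Freq n) (c : ℂ) :
    synthesis n (lp.single 2 k c) = c • monomialL2 k.1 := by
  simp [synthesis, OrthogonalFamily.linearIsometry_apply_single]

end Monomials

section FreqNorm

variable {n : ℕ}

theorem freqNorm_eq_norm (k : Fin n → ℤ) : freqNorm k = ‖WithLp.toLp 2 fun i => (k i : ℝ)‖ := by
  rw [EuclideanSpace.norm_eq, freqNorm]
  simp

theorem freqNorm_nonneg (k : Fin n → ℤ) : 0 ≤ freqNorm k := Real.sqrt_nonneg _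

theorem one_le_freqNorm {k : Fin n → ℤ} (hk : k ≠ 0) : 1 ≤ freqNorm k := by
  obtain ⟨i, hi⟩ := Function.ne_iff.1 hk
  rw [freqNorm, Real.one_le_sqrt]
  calc (1 : ℝ) ≤ (k i : ℝ) ^ 2 := by exact_mod_cast Int.add_one_le_iff.2 (sq_pos_of_ne_zero hi)
    _ ≤ ∑ i, (k i : ℝ) ^ 2 :=
        Finset.single_le_sum (f := fun i => (k i : ℝ) ^ 2) (fun _ _ => sq_nonneg _)
          (Finset.mem_univ i)

theorem freqNorm_pos {k : Fin n → ℤ} (hk : k ≠ 0) : 0 < freqNorm k :=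
  zero_lt_one.trans_le (one_le_freqNorm hk)

theorem abs_freqNorm_sub_le (k l : Fin n → ℤ) :
    |freqNorm k - freqNorm l| ≤ freqNorm (k - l) := by
  simp only [freqNorm_eq_norm]
  refine (abs_norm_sub_norm_le _ _).trans_eq ?_
  rw [← WithLp.toLp_sub]
  congr 2
  ext i
  simp

theorem summable_freqNorm_rpow_neg {N : ℝ} (hN : (n : ℝ) < N) :
    Summable fun k : Fin n → ℤ => freqNorm k ^ (-N) := by
  let b := (EuclideanSpace.basisFun (Fin n) ℝ).toBasis
  let L : Submodule ℤ (EuclideanSpace ℝ (Fin n)) := Submodule.span ℤ (Set.range b)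
  have hmem (k : Fin n → ℤ) : (WithLp.toLp 2 fun i => (k i : ℝ)) ∈ L := by
    have hsum : (WithLp.toLp 2 fun i => (k i : ℝ)) = ∑ i, k i • b i := by
      ext i
      simp [b, Pi.single_apply]
    rw [hsum]
    exact Submodule.sum_mem _ fun i _ =>
      Submodule.smul_mem _ _ (Submodule.subset_span ⟨i, rfl⟩)
  have hrank : Module.finrank ℤ L = n := by
    rw [ZLattice.rank ℝ L, finrank_euclideanSpace_fin]
  have hsummable := ZLattice.summable_norm_rpow L (-N) (by rw [hrank]; linarith)
  have hinj : Function.Injective fun k : Fin n → ℤ => (⟨_, hmem k⟩ : L) := fun k l h => by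
    ext i
    exact Int.cast_injective (α := ℝ) (congrArg (fun v : L => v.1 i) h)
  refine (hsummable.comp_injective hinj).congr fun k => ?_
  rw [Function.comp_apply, freqNorm_eq_norm]
  rfl

theorem summable_one_add_freqNorm_rpow_neg {N : ℝ} (hN : (n : ℝ) < N) :
    Summable fun k : Fin n → ℤ => (1 + freqNorm k) ^ (-N) := by
  refine (summable_freqNorm_rpow_neg hN).of_norm_bounded_eventually ?_
  filter_upwards [Set.finite_singleton 0 |>.compl_mem_cofinite] with k hk
  rw [Real.norm_of_nonneg (Real.rpow_nonneg (by linarith [freqNorm_nonneg k]) _)]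
  exact Real.rpow_le_rpow_of_nonpos (freqNorm_pos hk) (by linarith)
    (neg_nonpos.2 (n.cast_nonneg.trans hN.le))

end FreqNorm

section ProjNorm

variable {d n : ℕ}

theorem projNorm_nonneg (P : Matrix (Fin d) (Fin n) ℝ) (k : Fin n → ℤ) : 0 ≤ projNorm P k :=
  Real.sqrt_nonneg _

theorem projNorm_sq (P : Matrix (Fin d) (Fin n) ℝ) (k : Fin n → ℤ) :
    projNorm P k ^ 2 = ∑ j, projFreq P k j ^ 2 :=
  Real.sq_sqrt (Finset.sum_nonneg fun _ _ => sq_nonneg _)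

theorem projNorm_eq_zero_iff {P : Matrix (Fin d) (Fin n) ℝ} {k : Fin n → ℤ} :
    projNorm P k = 0 ↔ projFreq P k = 0 := by
  rw [← sq_eq_zero_iff, projNorm_sq, Finset.sum_eq_zero_iff_of_nonneg fun _ _ => sq_nonneg _]
  simp [funext_iff]

theorem isProjectionMatrix_iff {P : Matrix (Fin d) (Fin n) ℝ} :
    IsProjectionMatrix P ↔ ∀ k : Fin n → ℤ, k ≠ 0 → 0 < projNorm P k := by
  have hsum (k : Fin n → ℤ) : ∑ i, k i • P.col i = projFreq P k := by
    ext j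
    simp [projFreq, Matrix.mulVec, dotProduct, mul_comm]
  rw [IsProjectionMatrix, ← LinearIndependent.iff_fractionRing ℤ ℚ, Fintype.linearIndependent_iff]
  simp only [hsum, ← projNorm_eq_zero_iff, (projNorm_nonneg P _).lt_iff_ne']
  exact forall_congr' fun k => (imp_congr_right fun _ => funext_iff.symm).trans not_imp_not.symm

theorem IsProjectionMatrix.projNorm_pos {P : Matrix (Fin d) (Fin n) ℝ} (hP : IsProjectionMatrix P)
    {k : Fin n → ℤ} (hk : k ≠ 0) : 0 < projNorm P k :=
  isProjectionMatrix_iff.1 hP k hk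

theorem exists_projNorm_le_mul_freqNorm (P : Matrix (Fin d) (Fin n) ℝ) :
    ∃ C : ℝ, 1 ≤ C ∧ ∀ k, projNorm P k ≤ C * freqNorm k := by
  refine ⟨max 1 √(∑ j, ∑ i, P j i ^ 2), le_max_left _ _, fun k => ?_⟩
  calc projNorm P k ≤ √(∑ j, ∑ i, P j i ^ 2) * freqNorm k := by
        rw [projNorm, freqNorm, ← Real.sqrt_mul (by positivity), Finset.sum_mul]
        exact Real.sqrt_le_sqrt (Finset.sum_le_sum fun j _ =>
          Finset.sum_mul_sq_le_sq_mul_sq Finset.univ (P j) fun i => (k i : ℝ))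
    _ ≤ _ := mul_le_mul_of_nonneg_right (le_max_right _ _) (freqNorm_nonneg k)

/-- The bound `|P k| ≥ c |k|^{-ρ}` for all `k ≠ 0`. Compared with `IsDiophantine`, the exponent
may have any sign; `ρ = -1` says that `|P k|` is comparable to `|k|`. -/
def HasFreqLowerBound (P : Matrix (Fin d) (Fin n) ℝ) (ρ : ℝ) : Prop :=
  ∃ c : ℝ, 0 < c ∧ ∀ k : Fin n → ℤ, k ≠ 0 → c * freqNorm k ^ (-ρ) ≤ projNorm P k

theorem HasFreqLowerBound.isProjectionMatrix {P : Matrix (Fin d) (Fin n) ℝ} {ρ : ℝ}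
    (hρ : HasFreqLowerBound P ρ) : IsProjectionMatrix P := by
  obtain ⟨c, hc, hle⟩ := hρ
  exact isProjectionMatrix_iff.2 fun k hk =>
    (mul_pos hc (Real.rpow_pos_of_pos (freqNorm_pos hk) _)).trans_le (hle k hk)

theorem IsProjectionMatrix.hasFreqLowerBound_neg_one {P : Matrix (Fin d) (Fin n) ℝ}
    (hP : IsProjectionMatrix P) (hn : n ≤ 1) : HasFreqLowerBound P (-1) := by
  simp only [HasFreqLowerBound, neg_neg, Real.rpow_one]
  interval_cases n
  · exact ⟨1, one_pos, fun k hk => (hk (Subsingleton.elim _ _)).elim⟩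
  · refine ⟨projNorm P 1, hP.projNorm_pos one_ne_zero, fun k _ => le_of_eq ?_⟩
    rw [projNorm, freqNorm, projNorm, ← Real.sqrt_mul (by positivity), Finset.sum_mul]
    congr 1
    refine Finset.sum_congr rfl fun j _ => ?_
    simp [projFreq, Matrix.mulVec, dotProduct, mul_pow]

/-- For `n ≤ 1` the Diophantine exponent can be improved to `-1`, which compensates for `n / 2`
being as small as `1 / 2`. -/
theorem IsDiophantine.exists_exponent {P : Matrix (Fin d) (Fin n) ℝ} {s τ N : ℝ}
    (hD : IsDiophantine P τ) (hN : (n : ℝ) + s + τ < N) :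
    ∃ ρ : ℝ, -1 ≤ ρ ∧ ρ ≤ τ ∧ (n : ℝ) / 2 + (s + 1 + ρ) < N ∧ HasFreqLowerBound P ρ := by
  obtain ⟨hτ, hτP : HasFreqLowerBound P τ⟩ := hD
  rcases le_or_gt n 1 with hn | hn
  · exact ⟨-1, le_rfl, by linarith, by linarith [n.cast_nonneg (α := ℝ)],
      hτP.isProjectionMatrix.hasFreqLowerBound_neg_one hn⟩
  · have hn₂ : (2 : ℝ) ≤ n := by exact_mod_cast hn
    exact ⟨τ, by linarith, le_rfl, by linarith, hτP⟩

/-- The `j`-th component of the unit vector in the direction of `P k`; it is `0` if `P k = 0`. -/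
noncomputable def unitFreq (P : Matrix (Fin d) (Fin n) ℝ) (k : Fin n → ℤ) (j : Fin d) : ℝ :=
  projFreq P k j / projNorm P k

theorem sum_unitFreq_sq (P : Matrix (Fin d) (Fin n) ℝ) (k : Fin n → ℤ) :
    ∑ j, unitFreq P k j ^ 2 = projNorm P k ^ 2 / projNorm P k ^ 2 := by
  simp only [unitFreq, div_pow, ← Finset.sum_div, ← projNorm_sq]

theorem sum_unitFreq_sq_le_one (P : Matrix (Fin d) (Fin n) ℝ) (k : Fin n → ℤ) :
    ∑ j, unitFreq P k j ^ 2 ≤ 1 :=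
  (sum_unitFreq_sq P k).trans_le (div_self_le_one _)

theorem IsProjectionMatrix.sum_unitFreq_sq_eq_one {P : Matrix (Fin d) (Fin n) ℝ}
    (hP : IsProjectionMatrix P) {k : Fin n → ℤ} (hk : k ≠ 0) : ∑ j, unitFreq P k j ^ 2 = 1 :=
  (sum_unitFreq_sq P k).trans (div_self (pow_pos (hP.projNorm_pos hk) 2).ne')

theorem abs_unitFreq_le_one (P : Matrix (Fin d) (Fin n) ℝ) (k : Fin n → ℤ) (j : Fin d) :
    |unitFreq P k j| ≤ 1 := by
  rw [← sq_le_one_iff_abs_le_one]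
  exact (Finset.single_le_sum (f := fun j => unitFreq P k j ^ 2) (fun _ _ => sq_nonneg _)
    (Finset.mem_univ j)).trans (sum_unitFreq_sq_le_one P k)

theorem abs_sum_unitFreq_mul_le_one (P : Matrix (Fin d) (Fin n) ℝ) (k l : Fin n → ℤ) :
    |∑ j, unitFreq P k j * unitFreq P l j| ≤ 1 := by
  rw [← sq_le_one_iff_abs_le_one]
  exact (Finset.sum_mul_sq_le_sq_mul_sq _ _ _).trans
    (mul_le_one₀ (sum_unitFreq_sq_le_one P k) (Finset.sum_nonneg fun _ _ => sq_nonneg _)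
      (sum_unitFreq_sq_le_one P l))

end ProjNorm

section Series

variable {d n : ℕ}

theorem tsum_freq {E : Type*} [AddCommMonoid E] [TopologicalSpace E] {f : (Fin n → ℤ) → E}
    (hf : f 0 = 0) : ∑' k : Freq n, f k.1 = ∑' k, f k :=
  tsum_subtype_eq_of_support_subset (s := {k | k ≠ 0}) fun k hk h0 => hk (by rw [h0, hf])

theorem summable_freq_iff {f : (Fin n → ℤ) → ℝ} (hf : f 0 = 0) :
    (Summable fun k : Freq n => f k.1) ↔ Summable f :=
  Subtype.val_injective.summable_iff (f := f) fun k hk => by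
    by_contra h
    exact hk ⟨⟨k, fun h0 => h (by rw [h0, hf])⟩, rfl⟩

theorem norm_rpow_mul_norm_sq {x : ℝ} (hx : 0 ≤ x) (s : ℝ) (z : ℂ) :
    ‖x ^ s * ‖z‖‖ ^ 2 = x ^ (2 * s) * ‖z‖ ^ 2 := by
  rw [Real.norm_eq_abs, sq_abs, mul_pow, mul_comm 2 s, Real.rpow_mul hx, Real.rpow_two]

theorem mem_HbarP0_iff {P : Matrix (Fin d) (Fin n) ℝ} {s : ℝ} {U : FourierSeries n} :
    U ∈ HbarP0 P s ↔
      U 0 = 0 ∧ Memℓp (fun k : Freq n => projNorm P k.1 ^ s * ‖U k.1‖) 2 := by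
  refine and_congr_right fun hU => ?_
  simp only [memℓp_two_iff_summable_sq, norm_rpow_mul_norm_sq (projNorm_nonneg P _)]
  exact (summable_freq_iff (f := fun k => projNorm P k ^ (2 * s) * ‖U k‖ ^ 2) (by simp [hU])).symm

theorem mem_HbarP0_neg_one_iff {P : Matrix (Fin d) (Fin n) ℝ} {U : FourierSeries n} :
    U ∈ HbarP0 P (-1) ↔ U 0 = 0 ∧ Memℓp (fun k : Freq n => U k.1 / projNorm P k.1) 2 := by
  rw [mem_HbarP0_iff]
  refine and_congr_right fun _ => ⟨fun h => h.mono' fun k => ?_, fun h => h.mono' fun k => ?_⟩ <;>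
    simp [Real.rpow_neg_one, div_eq_inv_mul]

theorem rpow_le_two_rpow_abs_mul_rpow {x y : ℝ} (hx : 0 < x) (hy : 0 < y) (hxy : x ≤ 2 * y)
    (hyx : y ≤ 2 * x) (b : ℝ) : x ^ b ≤ 2 ^ |b| * y ^ b := by
  rw [← div_le_iff₀ (by positivity), ← Real.div_rpow hx.le hy.le]
  rcases le_total 0 b with hb | hb
  · rw [abs_of_nonneg hb]
    exact Real.rpow_le_rpow (by positivity) ((div_le_iff₀ hy).2 hxy) hb
  · rw [abs_of_nonpos hb, ← neg_neg b, Real.rpow_neg (by positivity), neg_neg,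
      ← Real.inv_rpow (by positivity), inv_div]
    exact Real.rpow_le_rpow (by positivity) ((div_le_iff₀ hx).2 hyx) (neg_nonneg.2 hb)

theorem mem_H0_iff {b : ℝ} {U : FourierSeries n} :
    U ∈ H0 n b ↔ U 0 = 0 ∧ Memℓp (fun k : Freq n => freqNorm k.1 ^ b * ‖U k.1‖) 2 := by
  refine and_congr_right fun hU => ?_
  simp only [memℓp_two_iff_summable_sq, norm_rpow_mul_norm_sq (freqNorm_nonneg _),
    Real.rpow_mul (freqNorm_nonneg _), Real.rpow_two]
  rw [← summable_freq_iff (by simp [hU])]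
  have hpos (k : Freq n) : 0 < freqNorm k.1 := freqNorm_pos k.2
  have hone (k : Freq n) : 1 ≤ freqNorm k.1 ^ 2 := one_le_pow₀ (one_le_freqNorm k.2)
  constructor <;> intro h <;>
    refine .of_nonneg_of_le (fun k => by positivity) (fun k => ?_) (h.mul_left (2 ^ |b|)) <;>
    rw [← mul_assoc] <;> gcongr
  · exact rpow_le_two_rpow_abs_mul_rpow (pow_pos (hpos k) 2) (by positivity)
      (by linarith [hone k]) (by linarith [hone k]) b
  · exact rpow_le_two_rpow_abs_mul_rpow (by positivity) (pow_pos (hpos k) 2)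
      (by linarith [hone k]) (by linarith [hone k]) b

theorem H0_subset_H0 {a b : ℝ} (hab : a ≤ b) : H0 n b ⊆ H0 n a := fun _ hU =>
  ⟨hU.1, hU.2.of_nonneg_of_le (fun k => by positivity) fun k => by
    gcongr
    exact le_add_of_nonneg_right (sq_nonneg _)⟩

theorem HasFreqLowerBound.memℓp_div_projNorm {P : Matrix (Fin d) (Fin n) ℝ} {ρ b : ℝ}
    (hρ : HasFreqLowerBound P ρ) {z : Freq n → ℂ}
    (hz : Memℓp (fun k : Freq n => freqNorm k.1 ^ (b + ρ) * ‖z k‖) 2) :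
    Memℓp (fun k : Freq n => freqNorm k.1 ^ b * ‖z k / projNorm P k.1‖) 2 := by
  obtain ⟨c, hc, hle⟩ := hρ
  refine (hz.const_mul c⁻¹).mono' fun k => ?_
  have hk : 0 < freqNorm k.1 := freqNorm_pos k.2
  have : 0 < c * freqNorm k.1 ^ (-ρ) := by positivity
  rw [Real.norm_of_nonneg (by positivity), norm_div, Complex.norm_real,
    Real.norm_of_nonneg (projNorm_nonneg P _)]
  calc freqNorm k.1 ^ b * (‖z k‖ / projNorm P k.1)
      ≤ freqNorm k.1 ^ b * (‖z k‖ / (c * freqNorm k.1 ^ (-ρ))) := by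
        gcongr
        exact hle k.1 k.2
    _ = c⁻¹ * (freqNorm k.1 ^ (b + ρ) * ‖z k‖) := by
        rw [Real.rpow_neg hk.le, Real.rpow_add hk]
        field_simp
    _ ≤ _ := Real.le_norm_self _

theorem HasFreqLowerBound.H0_subset_HbarP0 {P : Matrix (Fin d) (Fin n) ℝ} {ρ : ℝ}
    (hρ : HasFreqLowerBound P ρ) : H0 n ρ ⊆ HbarP0 P (-1) := fun U hU => by
  rw [mem_H0_iff, ← zero_add ρ] at hU
  exact mem_HbarP0_neg_one_iff.2 ⟨hU.1, (hρ.memℓp_div_projNorm hU.2).mono' fun k => by simp⟩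

open Classical in
/-- The mean zero Fourier series with coefficients `u k / |P k|`; this undoes the rescaling. -/
noncomputable def toSeries (P : Matrix (Fin d) (Fin n) ℝ) (u : SeqSpace n) : FourierSeries n :=
  fun k => if h : k ≠ 0 then u ⟨k, h⟩ / projNorm P k else 0

theorem toSeries_zero_apply (P : Matrix (Fin d) (Fin n) ℝ) (u : SeqSpace n) :
    toSeries P u 0 = 0 := by
  simp [toSeries]

theorem toSeries_apply (P : Matrix (Fin d) (Fin n) ℝ) (u : SeqSpace n) (k : Freq n) :
    toSeries P u k.1 = u k / projNorm P k.1 := by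
  simp [toSeries, k.2]

theorem IsProjectionMatrix.mem_HbarP0_one_iff {P : Matrix (Fin d) (Fin n) ℝ}
    (hP : IsProjectionMatrix P) {U : FourierSeries n} :
    U ∈ HbarP0 P 1 ↔ ∃ u : SeqSpace n, toSeries P u = U := by
  have hpos (k : Freq n) : (projNorm P k.1 : ℂ) ≠ 0 := by exact_mod_cast (hP.projNorm_pos k.2).ne'
  rw [mem_HbarP0_iff]
  constructor
  · rintro ⟨hU₀, hU⟩
    refine ⟨⟨fun k => projNorm P k.1 * U k.1, hU.mono' fun k => by simp⟩, ?_⟩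
    ext k
    by_cases hk : k = 0
    · rw [hk, toSeries_zero_apply, hU₀]
    · exact (toSeries_apply P _ ⟨k, hk⟩).trans (mul_div_cancel_left₀ _ (hpos ⟨k, hk⟩))
  · rintro ⟨u, rfl⟩
    refine ⟨toSeries_zero_apply P u, (lp.memℓp u).mono' fun k => ?_⟩
    rw [norm_mul, norm_norm, Real.rpow_one, ← Complex.norm_real, ← norm_mul, toSeries_apply,
      mul_div_cancel₀ _ (hpos k)]

end Series

section EnergyOp

variable {d n : ℕ} {P : Matrix (Fin d) (Fin n) ℝ} {A : Torus n → ℝ}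

/-- The map sending the rescaled coefficients `|P k| U_k` of a Fourier series `U` to the `j`-th
component of `P ∇ U`. -/
noncomputable def gradOp (P : Matrix (Fin d) (Fin n) ℝ) (j : Fin d) :
    SeqSpace n →L[ℂ] Lp ℂ 2 (torusMeasure n) :=
  (synthesis n).toContinuousLinearMap ∘L
    diagOp (fun k : Freq n => Complex.I * (unitFreq P k.1 j : ℂ)) zero_le_one fun k => by
      simpa using abs_unitFreq_le_one P k.1 j

theorem gradOp_single (P : Matrix (Fin d) (Fin n) ℝ) (j : Fin d) (k : Freq n) :
    gradOp P j (lp.single 2 k 1) = (Complex.I * (unitFreq P k.1 j : ℂ)) • monomialL2 k.1 := by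
  simp [gradOp, diagOp_single, synthesis_single]

theorem norm_gradOp_sq (P : Matrix (Fin d) (Fin n) ℝ) (j : Fin d) (u : SeqSpace n) :
    ‖gradOp P j u‖ ^ 2 = ∑' k : Freq n, unitFreq P k.1 j ^ 2 * ‖u k‖ ^ 2 := by
  simp [gradOp, lp_two_norm_sq, mul_pow]

theorem IsProjectionMatrix.sum_norm_gradOp_sq (hP : IsProjectionMatrix P) (u : SeqSpace n) :
    ∑ j, ‖gradOp P j u‖ ^ 2 = ‖u‖ ^ 2 := by
  simp only [norm_gradOp_sq]
  rw [← Summable.tsum_finsetSum, lp_two_norm_sq]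
  · exact tsum_congr fun k => by rw [← Finset.sum_mul, hP.sum_unitFreq_sq_eq_one k.2, one_mul]
  · exact fun j _ => (lp_two_summable_sq u).of_nonneg_of_le (fun k => by positivity) fun k =>
      mul_le_of_le_one_left (sq_nonneg _)
        ((sq_le_one_iff_abs_le_one _).2 (abs_unitFreq_le_one P k.1 j))

theorem projGrad_toSeries (P : Matrix (Fin d) (Fin n) ℝ) (j : Fin d) (u : SeqSpace n) :
    projGrad P (toSeries P u) j = gradOp P j u := by
  rw [projGrad, ← tsum_freq (by simp [toSeries_zero_apply])]
  simp only [gradOp, ContinuousLinearMap.comp_apply, LinearIsometry.coe_toContinuousLinearMap,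
    synthesis_apply, diagOp_apply, toSeries_apply]
  refine tsum_congr fun k => ?_
  congr 1
  simp only [unitFreq, Complex.ofReal_div]
  ring

/-- The operator on rescaled coefficients that represents the energy form of the coefficient
`A`. -/
noncomputable def energyOp (P : Matrix (Fin d) (Fin n) ℝ)
    (hA : MemLp (fun y => (A y : ℂ)) ⊤ (torusMeasure n)) : SeqSpace n →L[ℂ] SeqSpace n :=
  ∑ j, (gradOp P j).adjoint ∘L mulOp hA ∘L gradOp P j

variable {hA : MemLp (fun y => (A y : ℂ)) ⊤ (torusMeasure n)}

theorem inner_energyOp (u v : SeqSpace n) :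
    inner ℂ v (energyOp P hA u) = ∑ j, inner ℂ (gradOp P j v) (mulOp hA (gradOp P j u)) := by
  simp [energyOp, ContinuousLinearMap.adjoint_inner_right]

theorem energyForm_toSeries (hA : MemLp (fun y => (A y : ℂ)) ⊤ (torusMeasure n))
    (u v : SeqSpace n) :
    energyForm P A (toSeries P u) (toSeries P v) = inner ℂ v (energyOp P hA u) := by
  simp only [energyForm, projGrad_toSeries, Finset.mul_sum]
  rw [integral_finsetSum _ fun j _ => integrable_mul_mul_conj hA _ _, inner_energyOp]
  simp only [inner_mulOp]

theorem IsProjectionMatrix.mul_norm_sq_le_re_inner_energyOp (hP : IsProjectionMatrix P) {α : ℝ}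
    (hα : ∀ y, α ≤ A y) (u : SeqSpace n) :
    α * ‖u‖ ^ 2 ≤ RCLike.re (inner ℂ u (energyOp P hA u)) := by
  rw [inner_energyOp, ← hP.sum_norm_gradOp_sq u, Finset.mul_sum, map_sum]
  exact Finset.sum_le_sum fun j _ => mul_norm_sq_le_re_inner_mulOp hA hα _

theorem inner_monomialL2_mulOp (hA : MemLp (fun y => (A y : ℂ)) ⊤ (torusMeasure n))
    (k l : Fin n → ℤ) :
    inner ℂ (monomialL2 k) (mulOp hA (monomialL2 l)) = fourierCoeffReal A (k - l) := by
  rw [inner_mulOp, fourierCoeffReal]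
  refine integral_congr_ae ?_
  filter_upwards [ContinuousMap.coeFn_toLp (p := 2) (𝕜 := ℂ) (torusMeasure n) (monomial k),
    ContinuousMap.coeFn_toLp (p := 2) (𝕜 := ℂ) (torusMeasure n) (monomial l)] with y hk hl
  rw [monomialL2, monomialL2, hk, hl, conj_monomial_sub]

theorem energyOp_single_apply (k l : Freq n) :
    energyOp P hA (lp.single 2 l 1) k =
      ((∑ j, unitFreq P k.1 j * unitFreq P l.1 j : ℝ) : ℂ) * fourierCoeffReal A (k.1 - l.1) := by
  have hcoord : energyOp P hA (lp.single 2 l 1) k =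
      inner ℂ (lp.single 2 k 1) (energyOp P hA (lp.single 2 l 1)) := by
    rw [lp.inner_single_left, RCLike.inner_apply, map_one, mul_one]
  rw [hcoord, inner_energyOp, Complex.ofReal_sum, Finset.sum_mul]
  refine Finset.sum_congr rfl fun j _ => ?_
  rw [gradOp_single, gradOp_single, map_smul, inner_smul_left, inner_smul_right,
    inner_monomialL2_mulOp]
  simp only [map_mul, Complex.conj_I, Complex.conj_ofReal, Complex.ofReal_mul]
  linear_combination (-(unitFreq P k.1 j : ℂ) * unitFreq P l.1 j *
    fourierCoeffReal A (k.1 - l.1)) * Complex.I_mul_I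

theorem norm_energyOp_single_apply_le (k l : Freq n) :
    ‖energyOp P hA (lp.single 2 l 1) k‖ ≤ ‖fourierCoeffReal A (k.1 - l.1)‖ := by
  rw [energyOp_single_apply, norm_mul, Complex.norm_real]
  exact mul_le_of_le_one_left (norm_nonneg _) (abs_sum_unitFreq_mul_le_one P k.1 l.1)

theorem pairing_toSeries {F : FourierSeries n} {f : SeqSpace n}
    (hf : ∀ k : Freq n, f k = F k.1 / projNorm P k.1) (v : SeqSpace n) :
    pairing F (toSeries P v) = inner ℂ v f := by
  rw [pairing, ← tsum_freq (by simp [toSeries_zero_apply]), lp.inner_eq_tsum]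
  refine tsum_congr fun k => ?_
  rw [toSeries_apply, RCLike.inner_apply, hf, map_div₀, Complex.conj_ofReal]
  ring

theorem IsProjectionMatrix.isVariationalSolution_toSeries_iff (hP : IsProjectionMatrix P)
    (hA : MemLp (fun y => (A y : ℂ)) ⊤ (torusMeasure n)) {F : FourierSeries n} {f : SeqSpace n}
    (hf : ∀ k : Freq n, f k = F k.1 / projNorm P k.1) {u : SeqSpace n} :
    IsVariationalSolution P A F (toSeries P u) ↔ energyOp P hA u = f := by
  have hu : toSeries P u ∈ HbarP0 P 1 := hP.mem_HbarP0_one_iff.2 ⟨u, rfl⟩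
  simp only [IsVariationalSolution, hu, true_and, hP.mem_HbarP0_one_iff, forall_exists_index,
    forall_apply_eq_imp_iff, energyForm_toSeries hA, pairing_toSeries hf]
  exact (ext_iff_inner_left ℂ).symm

theorem IsElliptic.memLp_top (hA : IsElliptic A) (hm : AEMeasurable A (torusMeasure n)) :
    MemLp (fun y => (A y : ℂ)) ⊤ (torusMeasure n) := by
  obtain ⟨α₀, α₁, hα₀, hα⟩ := hA
  refine memLp_top_of_bound (Complex.measurable_ofReal.comp_aemeasurable hm).aestronglyMeasurable
    α₁ (.of_forall fun y => ?_)
  rw [Complex.norm_real, Real.norm_of_nonneg (hα₀.le.trans (hα y).1)]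
  exact (hα y).2

theorem existsUnique_isVariationalSolution (hP : IsProjectionMatrix P)
    (hm : AEMeasurable A (torusMeasure n)) (hA : IsElliptic A) {F : FourierSeries n}
    (hF : F ∈ HbarP0 P (-1)) : ∃! U : FourierSeries n, IsVariationalSolution P A F U := by
  have hA_top := hA.memLp_top hm
  obtain ⟨α₀, _, hα₀, hα⟩ := hA
  have hbij := ContinuousLinearMap.isUnit_iff_bijective.1 <| isUnit_of_coercive hα₀ <|
    hP.mul_norm_sq_le_re_inner_energyOp (hA := hA_top) fun y => (hα y).1
  let f : SeqSpace n := ⟨_, (mem_HbarP0_neg_one_iff.1 hF).2⟩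
  have hsol (u : SeqSpace n) :
      IsVariationalSolution P A F (toSeries P u) ↔ energyOp P hA_top u = f :=
    hP.isVariationalSolution_toSeries_iff hA_top fun _ => rfl
  obtain ⟨u, hu⟩ := hbij.surjective f
  refine ⟨toSeries P u, (hsol u).2 hu, fun V hV => ?_⟩
  obtain ⟨v, rfl⟩ := hP.mem_HbarP0_one_iff.1 hV.1
  rw [hbij.injective (((hsol v).1 hV).trans hu.symm)]

end EnergyOp

section Weights

theorem exists_abs_rpow_sub_one_le (σ : ℝ) {η : ℝ} (hη : 0 < η) :
    ∃ t : ℝ, 0 < t ∧ ∀ r : ℝ, |r - 1| ≤ t → |r ^ σ - 1| ≤ η := by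
  have hcont := Real.continuousAt_rpow_const 1 σ (Or.inl one_ne_zero)
  obtain ⟨δ, hδ, hball⟩ := Metric.continuousAt_iff.1 hcont η hη
  refine ⟨δ / 2, by positivity, fun r hr => ?_⟩
  have hr' := hball (x := r) (by rw [Real.dist_eq]; linarith)
  rw [Real.dist_eq, Real.one_rpow] at hr'
  exact hr'.le

theorem abs_max_sub_max_le_abs_left (x y R : ℝ) : |max R x - max R y| ≤ |x - y| := by
  rw [max_comm R, max_comm R]
  exact abs_max_sub_max_le_abs x y R

theorem exists_abs_max_rpow_div_sub_one_le (σ : ℝ) {η : ℝ} (hη : 0 < η) :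
    ∃ t : ℝ, 0 < t ∧ ∀ R x y : ℝ, 0 < R → |x - y| ≤ t * max R y →
      |max R x ^ σ / max R y ^ σ - 1| ≤ η := by
  obtain ⟨t, ht, hle⟩ := exists_abs_rpow_sub_one_le σ hη
  refine ⟨t, ht, fun R x y hR hxy => ?_⟩
  have hy : 0 < max R y := hR.trans_le (le_max_left R y)
  rw [← Real.div_rpow (hR.le.trans (le_max_left R x)) hy.le]
  refine hle _ ?_
  rw [div_sub_one hy.ne', abs_div, abs_of_pos hy, div_le_iff₀ hy]
  exact (abs_max_sub_max_le_abs_left x y R).trans hxy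

theorem abs_div_sub_one_le {a b q : ℝ} (ha : 0 ≤ a) (hb : 0 < b) (haq : a ≤ q) (hbq : b ≤ q) :
    |a / b - 1| ≤ q / b := by
  rw [div_sub_one hb.ne', abs_div, abs_of_pos hb]
  gcongr
  exact abs_le.2 ⟨by linarith, by linarith⟩

theorem rpow_neg_mul_rpow_neg_le {σ N p R x y q M : ℝ} (hp : 0 ≤ p) (hpσ : p ≤ N - σ)
    (hpN : 2 * p ≤ N) (hR : 0 < R) (hx : 0 < x) (hy : 0 < y) (hxq : x ≤ q) (hMq : M ≤ q)
    (hRM : R ≤ M) (hyM : y ≤ M) :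
    q ^ (-(N - σ)) * M ^ (-σ) ≤ R ^ (-(N - 2 * p)) * (x ^ (-p) * y ^ (-p)) := by
  have hM : 0 < M := hR.trans_le hRM
  have hq : 0 < q := hM.trans_le hMq
  have hqx : q ^ (-p) ≤ x ^ (-p) := Real.rpow_le_rpow_of_nonpos hx hxq (by linarith)
  have hqM : q ^ (-(N - σ - p)) ≤ M ^ (-(N - σ - p)) :=
    Real.rpow_le_rpow_of_nonpos hM hMq (by linarith)
  have hMy : M ^ (-p) ≤ y ^ (-p) := Real.rpow_le_rpow_of_nonpos hy hyM (by linarith)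
  have hMR : M ^ (-(N - 2 * p)) ≤ R ^ (-(N - 2 * p)) :=
    Real.rpow_le_rpow_of_nonpos hR hRM (by linarith)
  calc q ^ (-(N - σ)) * M ^ (-σ) = q ^ (-p) * q ^ (-(N - σ - p)) * M ^ (-σ) := by
        rw [← Real.rpow_add hq]
        ring_nf
    _ ≤ x ^ (-p) * M ^ (-(N - σ - p)) * M ^ (-σ) :=
        mul_le_mul_of_nonneg_right (mul_le_mul hqx hqM (by positivity) (by positivity))
          (by positivity)
    _ = x ^ (-p) * (M ^ (-p) * M ^ (-(N - 2 * p))) := by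
        rw [mul_assoc, ← Real.rpow_add hM, ← Real.rpow_add hM]
        ring_nf
    _ ≤ x ^ (-p) * (y ^ (-p) * R ^ (-(N - 2 * p))) :=
        mul_le_mul_of_nonneg_left (mul_le_mul hMy hMR (by positivity) (by positivity))
          (by positivity)
    _ = R ^ (-(N - 2 * p)) * (x ^ (-p) * y ^ (-p)) := by ring

theorem abs_max_rpow_div_sub_one_mul_le {σ N p t R x y m : ℝ} (hσ : 0 ≤ σ) (hp : 0 ≤ p)
    (hpσ : p ≤ N - σ) (hpN : 2 * p ≤ N) (ht : 0 < t) (hR : 0 < R) (hx : 0 < x) (hy : 0 < y)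
    (hm : t * max R y ≤ m) (hxy : |x - y| ≤ m) :
    |max R x ^ σ / max R y ^ σ - 1| * (1 + m) ^ (-N) ≤
      (1 + 1 / t) ^ N * (R ^ (-(N - 2 * p)) * (x ^ (-p) * y ^ (-p))) := by
  have hM : 0 < max R y := hR.trans_le (le_max_left R y)
  have hm₀ : 0 < m := (mul_pos ht hM).trans_le hm
  have hq : (1 + 1 / t) * m = m / t + m := by ring
  have hMq : max R y + m ≤ (1 + 1 / t) * m := by
    rw [hq]
    gcongr
    rwa [le_div_iff₀' ht]
  have hxq : max R x ≤ (1 + 1 / t) * m := by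
    linarith [le_abs_self (max R x - max R y), (abs_max_sub_max_le_abs_left x y R).trans hxy]
  have hratio : |max R x ^ σ / max R y ^ σ - 1| ≤ ((1 + 1 / t) * m) ^ σ / max R y ^ σ :=
    abs_div_sub_one_le (by positivity) (by positivity)
      (Real.rpow_le_rpow (by positivity) hxq hσ) (Real.rpow_le_rpow hM.le (by linarith) hσ)
  have hdecay : (1 + m) ^ (-N) ≤ (1 + 1 / t) ^ N * ((1 + 1 / t) * m) ^ (-N) := by
    rw [Real.mul_rpow (by positivity) hm₀.le, ← mul_assoc, ← Real.rpow_add (by positivity),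
      add_neg_cancel, Real.rpow_zero, one_mul]
    exact Real.rpow_le_rpow_of_nonpos hm₀ (by linarith) (by linarith)
  calc |max R x ^ σ / max R y ^ σ - 1| * (1 + m) ^ (-N)
      ≤ ((1 + 1 / t) * m) ^ σ / max R y ^ σ * ((1 + 1 / t) ^ N * ((1 + 1 / t) * m) ^ (-N)) := by
        gcongr
    _ = (1 + 1 / t) ^ N * (((1 + 1 / t) * m) ^ (-(N - σ)) * max R y ^ (-σ)) := by
        rw [neg_sub, sub_eq_add_neg, Real.rpow_add (by positivity), Real.rpow_neg hM.le]
        ring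
    _ ≤ _ := by
        refine mul_le_mul_of_nonneg_left ?_ (by positivity)
        exact rpow_neg_mul_rpow_neg_le hp hpσ hpN hR hx hy ((le_max_right R x).trans hxq)
          (by linarith) (le_max_left R y) (le_max_right R y)

end Weights

section Regularity

variable {n : ℕ}

/-- The weight `|k| ^ σ`, frozen at its value on the sphere of radius `R` for `|k| ≤ R`. The
freezing makes `freqWeight R σ k / freqWeight R σ l` uniformly close to `1` near the diagonal. -/
noncomputable def freqWeight (R σ : ℝ) (k : Freq n) : ℝ := max R (freqNorm k.1) ^ σ

theorem norm_freqWeight_div_sub_one (R σ : ℝ) (k l : Freq n) :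
    ‖(freqWeight R σ k : ℂ) / freqWeight R σ l - 1‖ =
      |max R (freqNorm k.1) ^ σ / max R (freqNorm l.1) ^ σ - 1| := by
  rw [← Real.norm_eq_abs, ← Complex.norm_real]
  simp [freqWeight]

theorem one_le_freqWeight {R σ : ℝ} (hσ : 0 ≤ σ) (k : Freq n) : 1 ≤ freqWeight R σ k :=
  Real.one_le_rpow ((one_le_freqNorm k.2).trans (le_max_right R _)) hσ

theorem rpow_freqNorm_le_freqWeight {σ : ℝ} (hσ : 0 ≤ σ) (R : ℝ) (k : Freq n) :
    freqNorm k.1 ^ σ ≤ freqWeight R σ k :=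
  Real.rpow_le_rpow (freqNorm_nonneg _) (le_max_right R _) hσ

theorem freqWeight_le {R σ : ℝ} (hR : 1 ≤ R) (hσ : 0 ≤ σ) (k : Freq n) :
    freqWeight R σ k ≤ R ^ σ * freqNorm k.1 ^ σ := by
  have hk := one_le_freqNorm k.2
  rw [← Real.mul_rpow (by linarith) (by linarith)]
  exact Real.rpow_le_rpow (by positivity) (max_le (le_mul_of_one_le_right (by linarith) hk)
    (le_mul_of_one_le_left (by linarith) hR)) hσ

theorem summable_rpow_neg_freqNorm_sq {p : ℝ} (hp : (n : ℝ) / 2 < p) :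
    Summable fun k : Freq n => (freqNorm k.1 ^ (-p)) ^ 2 := by
  refine ((summable_freqNorm_rpow_neg (n := n) (N := 2 * p) (by linarith)).comp_injective
    Subtype.val_injective).congr fun k => ?_
  rw [Function.comp_apply, ← Real.rpow_two, ← Real.rpow_mul (freqNorm_nonneg _)]
  ring_nf

open Classical in
theorem exists_near_conjugation_error (σ : ℝ) {N CA ε : ℝ} (hN : (n : ℝ) < N) (hε : 0 < ε)
    {b : Freq n → Freq n → ℂ}
    (hb : ∀ k l, ‖b k l‖ ≤ CA * (1 + freqNorm (k.1 - l.1)) ^ (-N)) :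
    ∃ t : ℝ, 0 < t ∧ ∀ R : ℝ, 0 < R → ∃ S : SeqSpace n →L[ℂ] SeqSpace n, ‖S‖ ≤ ε ∧
      ∀ k l, S (lp.single 2 l 1) k =
        if freqNorm (k.1 - l.1) ≤ t * max R (freqNorm l.1) then
          ((freqWeight R σ k : ℂ) / freqWeight R σ l - 1) * b k l else 0 := by
  have hdecay₀ (k : Fin n → ℤ) : 0 ≤ (1 + freqNorm k) ^ (-N) :=
    Real.rpow_nonneg (add_nonneg zero_le_one (freqNorm_nonneg k)) _
  have hdecay := summable_one_add_freqNorm_rpow_neg hN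
  obtain ⟨η, hη, hηε⟩ := exists_pos_mul_lt hε (|CA| * ∑' k : Fin n → ℤ, (1 + freqNorm k) ^ (-N))
  obtain ⟨t, ht, hratio⟩ := exists_abs_max_rpow_div_sub_one_le σ hη
  refine ⟨t, ht, fun R hR => ?_⟩
  obtain ⟨S, hS, hSkl⟩ := exists_clm_of_norm_le_sub
    (fun k l : Freq n => if freqNorm (k.1 - l.1) ≤ t * max R (freqNorm l.1) then
      ((freqWeight R σ k : ℂ) / freqWeight R σ l - 1) * b k l else 0)
    (g := fun k => η * |CA| * (1 + freqNorm k) ^ (-N)) Subtype.val_injective (hdecay.mul_left _)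
    (fun k => mul_nonneg (by positivity) (hdecay₀ k)) fun k l => by
      split_ifs with hnear
      · rw [norm_mul, norm_freqWeight_div_sub_one, mul_assoc]
        gcongr
        · exact hratio _ _ _ hR ((abs_freqNorm_sub_le _ _).trans hnear)
        · exact (hb k l).trans (mul_le_mul_of_nonneg_right (le_abs_self CA) (hdecay₀ _))
      · rw [norm_zero]
        exact mul_nonneg (by positivity) (hdecay₀ _)
  refine ⟨S, hS.trans ?_, hSkl⟩
  rw [tsum_mul_left, mul_assoc, mul_comm]
  exact hηε.le

theorem norm_far_conjugation_error_le {σ N p t R CA : ℝ} (hσ : 0 ≤ σ) (hp : 0 ≤ p)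
    (hpσ : p ≤ N - σ) (hpN : 2 * p ≤ N) (ht : 0 < t) (hR : 0 < R)
    {b : Freq n → Freq n → ℂ} {k l : Freq n}
    (hb : ‖b k l‖ ≤ CA * (1 + freqNorm (k.1 - l.1)) ^ (-N))
    (hfar : t * max R (freqNorm l.1) ≤ freqNorm (k.1 - l.1)) :
    ‖((freqWeight R σ k : ℂ) / freqWeight R σ l - 1) * b k l‖ ≤
      |CA| * (1 + 1 / t) ^ N * R ^ (-(N - 2 * p)) *
        (freqNorm k.1 ^ (-p) * freqNorm l.1 ^ (-p)) := by
  have hdecay₀ : 0 ≤ (1 + freqNorm (k.1 - l.1)) ^ (-N) :=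
    Real.rpow_nonneg (add_nonneg zero_le_one (freqNorm_nonneg _)) _
  rw [norm_mul, norm_freqWeight_div_sub_one]
  calc _ ≤ |max R (freqNorm k.1) ^ σ / max R (freqNorm l.1) ^ σ - 1| *
        (|CA| * (1 + freqNorm (k.1 - l.1)) ^ (-N)) := by
        gcongr
        exact hb.trans (mul_le_mul_of_nonneg_right (le_abs_self CA) hdecay₀)
    _ = |CA| * (|max R (freqNorm k.1) ^ σ / max R (freqNorm l.1) ^ σ - 1| *
        (1 + freqNorm (k.1 - l.1)) ^ (-N)) := by ring
    _ ≤ |CA| * ((1 + 1 / t) ^ N *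
        (R ^ (-(N - 2 * p)) * (freqNorm k.1 ^ (-p) * freqNorm l.1 ^ (-p)))) := by
        refine mul_le_mul_of_nonneg_left ?_ (abs_nonneg CA)
        exact abs_max_rpow_div_sub_one_mul_le hσ hp hpσ hpN ht hR (freqNorm_pos k.2)
          (freqNorm_pos l.2) hfar (abs_freqNorm_sub_le _ _)
    _ = _ := by ring

open Classical in
theorem exists_far_conjugation_error {σ N CA ε t : ℝ} (hσ : 0 ≤ σ) (hN : (n : ℝ) < N)
    (hNσ : (n : ℝ) / 2 < N - σ) (hε : 0 < ε) (ht : 0 < t) {b : Freq n → Freq n → ℂ}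
    (hb : ∀ k l, ‖b k l‖ ≤ CA * (1 + freqNorm (k.1 - l.1)) ^ (-N)) :
    ∃ R : ℝ, 1 ≤ R ∧ ∃ S : SeqSpace n →L[ℂ] SeqSpace n, ‖S‖ ≤ ε ∧
      ∀ k l, S (lp.single 2 l 1) k =
        if freqNorm (k.1 - l.1) ≤ t * max R (freqNorm l.1) then 0 else
          ((freqWeight R σ k : ℂ) / freqWeight R σ l - 1) * b k l := by
  obtain ⟨p, hnp, hp⟩ := exists_between (lt_min (by linarith : (n : ℝ) / 2 < N / 2) hNσ)
  rw [lt_min_iff] at hp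
  have hsmall : Filter.Tendsto (fun R : ℝ => |CA| * (1 + 1 / t) ^ N * R ^ (-(N - 2 * p)) *
      ∑' k : Freq n, (freqNorm k.1 ^ (-p)) ^ 2) Filter.atTop (nhds 0) := by
    simpa using ((tendsto_rpow_neg_atTop (by linarith : 0 < N - 2 * p)).const_mul
      (|CA| * (1 + 1 / t) ^ N)).mul_const (∑' k : Freq n, (freqNorm k.1 ^ (-p)) ^ 2)
  obtain ⟨R, hR, hRε⟩ :=
    ((Filter.eventually_ge_atTop 1).and (hsmall.eventually_le_const hε)).exists
  have hp₀ : 0 ≤ p := (by positivity : (0 : ℝ) ≤ n / 2).trans hnp.le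
  obtain ⟨S, hS, hSkl⟩ := exists_clm_of_norm_le_mul
    (fun k l : Freq n => if freqNorm (k.1 - l.1) ≤ t * max R (freqNorm l.1) then 0 else
      ((freqWeight R σ k : ℂ) / freqWeight R σ l - 1) * b k l)
    (φ := fun k => freqNorm k.1 ^ (-p)) (C := |CA| * (1 + 1 / t) ^ N * R ^ (-(N - 2 * p)))
    (by positivity) (fun k => Real.rpow_pos_of_pos (freqNorm_pos k.2) _)
    (summable_rpow_neg_freqNorm_sq hnp) fun k l => by
      have hk := freqNorm_nonneg k.1
      have hl := freqNorm_nonneg l.1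
      split_ifs with hnear
      · rw [norm_zero]
        positivity
      · exact norm_far_conjugation_error_le hσ hp₀ hp.2.le (by linarith) ht (by linarith) (hb k l)
          (not_le.1 hnear).le
  exact ⟨R, hR, S, hS.trans hRε, hSkl⟩

/-- The matrix with the entries of `S` is `W b W⁻¹ - b` for the diagonal matrix `W` of weights. -/
theorem exists_small_conjugation_error {σ N CA ε : ℝ} (hσ : 0 ≤ σ) (hN : (n : ℝ) < N)
    (hNσ : (n : ℝ) / 2 < N - σ) (hε : 0 < ε) {b : Freq n → Freq n → ℂ}
    (hb : ∀ k l, ‖b k l‖ ≤ CA * (1 + freqNorm (k.1 - l.1)) ^ (-N)) :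
    ∃ R : ℝ, 1 ≤ R ∧ ∃ S : SeqSpace n →L[ℂ] SeqSpace n, ‖S‖ ≤ ε ∧ ∀ k l,
      S (lp.single 2 l 1) k = ((freqWeight R σ k : ℂ) / freqWeight R σ l - 1) * b k l := by
  obtain ⟨t, ht, hnear⟩ := exists_near_conjugation_error σ hN (half_pos hε) hb
  obtain ⟨R, hR, S₂, hS₂, hS₂kl⟩ :=
    exists_far_conjugation_error hσ hN hNσ (half_pos hε) ht hb
  obtain ⟨S₁, hS₁, hS₁kl⟩ := hnear R (by linarith)
  refine ⟨R, hR, S₁ + S₂, ?_, fun k l => ?_⟩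
  · linarith [norm_add_le S₁ S₂]
  · rw [add_apply, lp.coeFn_add, Pi.add_apply, hS₁kl, hS₂kl]
    split_ifs <;> simp

theorem memℓp_rpow_freqNorm_mul_of_coercive {T : SeqSpace n →L[ℂ] SeqSpace n} {α σ N CA : ℝ}
    (hα : 0 < α) (hT : ∀ u, α * ‖u‖ ^ 2 ≤ RCLike.re (inner ℂ u (T u))) (hσ : 0 ≤ σ)
    (hN : (n : ℝ) < N) (hNσ : (n : ℝ) / 2 < N - σ)
    (hdecay : ∀ k l, ‖T (lp.single 2 l 1) k‖ ≤ CA * (1 + freqNorm (k.1 - l.1)) ^ (-N))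
    {u : SeqSpace n} (hu : Memℓp (fun k : Freq n => freqNorm k.1 ^ σ * ‖T u k‖) 2) :
    Memℓp (fun k : Freq n => freqNorm k.1 ^ σ * ‖u k‖) 2 := by
  obtain ⟨R, hR, S, hS, hSkl⟩ := exists_small_conjugation_error hσ hN hNσ (half_pos hα) hdecay
  have hweight₀ (k : Freq n) : 0 ≤ freqWeight R σ k := zero_le_one.trans (one_le_freqWeight hσ k)
  have hfreq₀ (k : Freq n) : 0 ≤ freqNorm k.1 ^ σ := Real.rpow_nonneg (freqNorm_nonneg _) _
  have hu_weight : Memℓp (fun k => (freqWeight R σ k : ℂ) * u k) 2 := by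
    refine memℓp_mul_of_coercive hα hT (fun k => ?_) hSkl (by linarith)
      ((hu.const_mul (R ^ σ)).mono' fun k => ?_)
    · simpa [abs_of_nonneg (hweight₀ k)] using one_le_freqWeight hσ k
    · simp only [norm_mul, norm_norm, Complex.norm_real, Real.norm_of_nonneg (hweight₀ k),
        Real.norm_of_nonneg (hfreq₀ k), ← mul_assoc]
      gcongr
      exact (freqWeight_le hR hσ k).trans
        (mul_le_mul_of_nonneg_right (Real.le_norm_self _) (hfreq₀ k))
  refine hu_weight.mono' fun k => ?_
  simp only [norm_mul, norm_norm, Complex.norm_real, Real.norm_of_nonneg (hweight₀ k),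
    Real.norm_of_nonneg (hfreq₀ k)]
  gcongr
  exact rpow_freqNorm_le_freqWeight hσ R k

end Regularity

theorem IsVariationalSolution.mem_H0 {d n : ℕ} {P : Matrix (Fin d) (Fin n) ℝ} {A : Torus n → ℝ}
    {b ρ N : ℝ} (hρ : HasFreqLowerBound P ρ) (hbρ : 0 ≤ b + ρ) (hN : (n : ℝ) < N)
    (hbN : (n : ℝ) / 2 + (b + ρ) < N) (hm : AEMeasurable A (torusMeasure n)) (hA : IsElliptic A)
    (hdecay : HasFourierDecay A N) {F U : FourierSeries n} (hF : F ∈ H0 n (b + ρ + ρ))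
    (hU : IsVariationalSolution P A F U) : U ∈ H0 n b := by
  have hP := hρ.isProjectionMatrix
  have hA_top := hA.memLp_top hm
  obtain ⟨α₀, _, hα₀, hα⟩ := hA
  obtain ⟨CA, _, hCA⟩ := hdecay
  obtain ⟨u, rfl⟩ := hP.mem_HbarP0_one_iff.1 hU.1
  have hF_dual : F ∈ HbarP0 P (-1) := hρ.H0_subset_HbarP0 (H0_subset_H0 (by linarith) hF)
  have hu : energyOp P hA_top u = ⟨_, (mem_HbarP0_neg_one_iff.1 hF_dual).2⟩ :=
    (hP.isVariationalSolution_toSeries_iff hA_top fun _ => rfl).1 hU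
  have hu_weighted : Memℓp (fun k : Freq n => freqNorm k.1 ^ (b + ρ) * ‖u k‖) 2 := by
    refine memℓp_rpow_freqNorm_mul_of_coercive hα₀
      (hP.mul_norm_sq_le_re_inner_energyOp (hA := hA_top) fun y => (hα y).1) hbρ hN
      (by linarith) (fun k l => norm_energyOp_single_apply_le k l |>.trans (hCA _)) ?_
    rw [hu]
    exact hρ.memℓp_div_projNorm (mem_H0_iff.1 hF).2
  refine mem_H0_iff.2 ⟨toSeries_zero_apply P u, ?_⟩
  simpa only [toSeries_apply] using hρ.memℓp_div_projNorm hu_weighted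

section Truncation

variable {n : ℕ}

theorem sub_fourierTrunc_apply {U : FourierSeries n} (hU : U 0 = 0) (K : ℝ) (k : Fin n → ℤ) :
    (U - fourierTrunc K U) k = if K < freqNorm k then U k else 0 := by
  by_cases hk : k = 0
  · simp [hk, fourierTrunc, hU]
  · by_cases hK : K < freqNorm k
    · simp [fourierTrunc, hK, hK.not_ge]
    · simp [fourierTrunc, hK, not_lt.1 hK, freqNorm_pos hk]

theorem sqrt_tsum_sub_fourierTrunc_le {b K B : ℝ} {U : FourierSeries n} (hU : U ∈ H0 n b)
    {w : (Fin n → ℤ) → ℝ} (hw : ∀ k, 0 ≤ w k) (hB : 0 ≤ B)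
    (hwB : ∀ k, K < freqNorm k → w k ≤ B ^ 2 * (1 + freqNorm k ^ 2) ^ b) :
    √(∑' k, w k * ‖(U - fourierTrunc K U) k‖ ^ 2) ≤ B * normH b U := by
  have hle (k : Fin n → ℤ) : w k * ‖(U - fourierTrunc K U) k‖ ^ 2 ≤
      B ^ 2 * ((1 + freqNorm k ^ 2) ^ b * ‖U k‖ ^ 2) := by
    rw [sub_fourierTrunc_apply hU.1]
    split_ifs with hk
    · rw [← mul_assoc]
      exact mul_le_mul_of_nonneg_right (hwB k hk) (by positivity)
    · rw [norm_zero, zero_pow two_ne_zero, mul_zero]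
      positivity
  have hsum := hU.2.mul_left (B ^ 2)
  rw [normH, ← Real.sqrt_sq hB, ← Real.sqrt_mul (by positivity), ← tsum_mul_left]
  exact Real.sqrt_le_sqrt (Summable.tsum_le_tsum hle
    (.of_nonneg_of_le (fun k => mul_nonneg (hw k) (by positivity)) hle hsum) hsum)

theorem one_le_rpow_neg_sq_mul {K x r : ℝ} (hK : 0 < K) (hx : K < x) (hr : 0 ≤ r) :
    1 ≤ (K ^ (-r)) ^ 2 * (1 + x ^ 2) ^ r := by
  rw [Real.rpow_neg hK.le, inv_pow, le_inv_mul_iff₀ (by positivity), mul_one]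
  calc (K ^ r) ^ 2 = (K ^ 2) ^ r := by
        rw [← Real.rpow_natCast, ← Real.rpow_natCast_mul hK.le, ← Real.rpow_mul hK.le, mul_comm]
    _ ≤ (1 + x ^ 2) ^ r := Real.rpow_le_rpow (by positivity) (by nlinarith) hr

theorem normHbarP_sub_fourierTrunc_le {d : ℕ} {P : Matrix (Fin d) (Fin n) ℝ} {C s K : ℝ}
    (hC : 0 ≤ C) (hPC : ∀ k, projNorm P k ≤ C * freqNorm k) (hs : 0 ≤ s) (hK : 0 < K)
    {U : FourierSeries n} (hU : U ∈ H0 n (s + 1)) :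
    normHbarP P 1 (U - fourierTrunc K U) ≤ C * K ^ (-s) * normH (s + 1) U := by
  refine sqrt_tsum_sub_fourierTrunc_le hU
    (fun k => Real.rpow_nonneg (projNorm_nonneg P k) _) (by positivity) fun k hk => ?_
  rw [mul_one, Real.rpow_two, Real.rpow_add (by positivity), Real.rpow_one]
  calc projNorm P k ^ 2 ≤ (C * freqNorm k) ^ 2 := pow_le_pow_left₀ (projNorm_nonneg P k) (hPC k) 2
    _ = C ^ 2 * freqNorm k ^ 2 * 1 := by ring
    _ ≤ C ^ 2 * (1 + freqNorm k ^ 2) * ((K ^ (-s)) ^ 2 * (1 + freqNorm k ^ 2) ^ s) := by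
        gcongr
        · linarith
        · exact one_le_rpow_neg_sq_mul hK hk hs
    _ = _ := by ring

theorem normL2_sub_fourierTrunc_le {b K : ℝ} (hb : 0 ≤ b) (hK : 0 < K) {U : FourierSeries n}
    (hU : U ∈ H0 n b) : normL2 (U - fourierTrunc K U) ≤ K ^ (-b) * normH b U := by
  simpa only [one_mul, normL2] using
    sqrt_tsum_sub_fourierTrunc_le hU (w := fun _ => 1) (fun _ => zero_le_one)
      (Real.rpow_nonneg hK.le (-b)) fun k hk => one_le_rpow_neg_sq_mul hK hk hb

end Truncation

theorem corollary3p4_general {d n : ℕ} (P : Matrix (Fin d) (Fin n) ℝ) :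
    ∃ C : ℝ, 0 < C ∧
      ∀ (s ρ N : ℝ) (A : Torus n → ℝ), 0 ≤ s → -1 ≤ ρ → HasFreqLowerBound P ρ →
        AEMeasurable A (torusMeasure n) → IsElliptic A → HasFourierDecay A N →
        (n : ℝ) < N → (n : ℝ) / 2 + (s + 1 + ρ) < N →
        ∀ F ∈ H0 n (2 * ρ + s + 1),
          (∃! U : FourierSeries n, IsVariationalSolution P A F U) ∧
          ∀ U : FourierSeries n, IsVariationalSolution P A F U →
            U ∈ H0 n (s + 1) ∧
            ∀ K : ℝ, 0 < K →
              normHbarP P 1 (U - fourierTrunc K U) ≤ C * K ^ (-s) * normH (s + 1) U ∧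
              normL2 (U - fourierTrunc K U) ≤ C * K ^ (-(s + 1)) * normH (s + 1) U := by
  obtain ⟨C, hC, hPC⟩ := exists_projNorm_le_mul_freqNorm P
  refine ⟨C, by linarith, fun s ρ N A hs hρ_ge hρ hm hA hdecay hN hsN F hF => ⟨?_, fun U hU => ?_⟩⟩
  · exact existsUnique_isVariationalSolution hρ.isProjectionMatrix hm hA
      (hρ.H0_subset_HbarP0 (H0_subset_H0 (by linarith) hF))
  · have hU_mem : U ∈ H0 n (s + 1) :=
      hU.mem_H0 hρ (by linarith) hN hsN hm hA hdecay (H0_subset_H0 (by linarith) hF)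
    refine ⟨hU_mem, fun K hK => ⟨?_, ?_⟩⟩
    · exact normHbarP_sub_fourierTrunc_le (by linarith) hPC hs hK hU_mem
    · rw [mul_assoc]
      exact (normL2_sub_fourierTrunc_le (by linarith) hK hU_mem).trans
        (le_mul_of_one_le_left (mul_nonneg (by positivity) (Real.sqrt_nonneg _)) hC)

end QuasiPer

theorem corollary3p4 {d n : ℕ} (P : Matrix (Fin d) (Fin n) ℝ) (hP : IsProjectionMatrix P) :
    ∃ C : ℝ, 0 < C ∧
      ∀ (s τ N : ℝ) (A : Torus n → ℝ), 0 ≤ s → IsDiophantine P τ →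
        AEMeasurable A (torusMeasure n) → IsElliptic A → HasFourierDecay A N →
        (n : ℝ) + s + τ < N →
        ∀ F ∈ H0 n (2 * τ + s + 1),
          (∃! U : FourierSeries n, IsVariationalSolution P A F U) ∧
          ∀ U : FourierSeries n, IsVariationalSolution P A F U →
            U ∈ H0 n (s + 1) ∧
            ∀ K : ℝ, 0 < K →
              normHbarP P 1 (U - fourierTrunc K U) ≤ C * K ^ (-s) * normH (s + 1) U ∧
              normL2 (U - fourierTrunc K U) ≤ C * K ^ (-(s + 1)) * normH (s + 1) U := by
  obtain ⟨C, hC, hgeneral⟩ := corollary3p4_general P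
  refine ⟨C, hC, fun s τ N A hs hD hm hA hdecay hN F hF => ?_⟩
  obtain ⟨ρ, hρ_ge, hρτ, hρN, hρ⟩ := hD.exists_exponent hN
  exact hgeneral s ρ N A hs hρ_ge hρ hm hA hdecay (by linarith [hD.1]) hρN F
    (H0_subset_H0 (by linarith) hF)
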